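/- \textbf{Lemma (One-shot continuity).} All quantum systems are finite-dimensional, and $\mathscr{D}(\mathcal{H})$ denotes the set of density operators (positive semidefinite, trace one) on $\mathcal{H}$. For a density operator $\rho$ and a positive semidefinite operator $\sigma$ on the same space, the measured divergence and, for $\alpha\in(0,1)$, the measured R\'enyi divergence are $$D_{\mathrm M}(\rho\|\sigma)=\sup_{(\mathcal X,M)} D(P_{\rho,M}\|P_{\sigma,M}),\qquad D_{\mathrm M,\alpha}(\rho\|\sigma)=\sup_{(\mathcal X,M)} D_\alpha(P_{\rho,M}\|P_{\sigma,M}),$$ where the suprema are over all finite sets $\mathcal X$ and all positive operator valued measures $M=(M_x)_{x\in\mathcal X}$ ($M_x\ge 0$, $\sum_x M_x=I$), $P_{\rho,M}(x)=\operatorname{tr}[M_x\rho]$, $D(P\|Q)=\sum_x P(x)\log\frac{P(x)}{Q(x)}$ if $P\ll Q$ and $+\infty$ otherwise, and $D_\alpha(P\|Q)=\frac{1}{\alpha-1}\log\sum_x P(x)^\alpha Q(x)^{1-\alpha}$ (equal to $+\infty$ if $P$ and $Q$ have disjoint supports). For $\mathbf D\in\{D_{\mathrm M}\}\cup\{D_{\mathrm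 M,\alpha}:\alpha\in(0,1)\}$, systems $A,E,B$, a completely positive trace-preserving map $\mathcal N_{AE\to B}$ and a completely positive map $\mathcal M_{AE\to B}$, the minimax channel divergence is $$\mathbf D^{\mathrm{mx}}(\mathcal N\|\mathcal M)=\sup_{\rho_{AR}\in\mathscr D(\mathcal H_A\otimes\mathcal H_R)}\ \inf_{\sigma_E,\,\omega_E\in\mathscr D(\mathcal H_E)}\mathbf D\big(\mathcal N_{AE\to B}(\rho_{AR}\otimes\sigma_E)\,\big\|\,\mathcal M_{AE\to B}(\rho_{AR}\otimes\omega_E)\big),$$ where $R$ is a reference system of arbitrary (finite) dimension, on which the maps act as the identity. Then, for every completely positive trace-preserving $\mathcal N_{AE\to B}$ and every completely positive $\mathcal M_{AE\to B}$ (not necessarily trace preserving), $$\sup_{\alpha\in(0,1)} D_{\mathrm M,\alpha}^{\mathrm{mx}}(\mathcal N\|\mathcal M)=D_{\mathrm M}^{\mathrm{mx}}(\mathcal N\|\mathcal M)$$ as an equality in $[-\infty,+\infty]$. -/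

import Mathlib

/- Finite-dimensional quantum systems are represented by finite index types `d` (the Hilbert space
is `ℂ^d`), and operators by complex matrices. The scoped instances below equip `Matrix d d ℂ` with
its usual C⋆-algebra structure (operator norm) and the Loewner order, so that
`Matrix d d ℂ →CP Matrix e e ℂ` is Mathlib's type of completely positive maps. -/
open scoped ComplexOrder MatrixOrder Matrix.Norms.L2Operator CStarAlgebra Kronecker

noncomputable section

namespace MinimaxChannel

universe u v w

/-- The set of density operators: positive semidefinite of trace one. -/
def Density (d : Type u) [Fintype d] : Set (Matrix d d ℂ) :=
  {ρ | ρ.PosSemidef ∧ ρ.trace = 1}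

/-- A positive operator valued measure on the system `d` with outcomes in the finite set `X`. -/
structure POVM (X : Type v) [Fintype X] (d : Type u) [Fintype d] [DecidableEq d] where
  effect : X → Matrix d d ℂ
  posSemidef : ∀ x, (effect x).PosSemidef
  sum_eq_one : ∑ x, effect x = 1

/-- The measure `x ↦ tr[M_x ρ]` of outcomes (real for positive semidefinite `ρ`). -/
def POVM.outcome {X : Type v} [Fintype X] {d : Type u} [Fintype d] [DecidableEq d]
    (M : POVM X d) (ρ : Matrix d d ℂ) : X → ℝ :=
  fun x => (M.effect x * ρ).trace.re

open Classical in
/-- The classical relative entropy `∑ x, P x log (P x / Q x)` of a probability vector `P` and a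
nonnegative vector `Q`, with the conventions `0 log (0 / q) = 0`, and `+∞` unless `P ≪ Q`. -/
def classicalDiv {X : Type v} [Fintype X] (P Q : X → ℝ) : EReal :=
  if ∀ x, Q x = 0 → P x = 0 then ((∑ x, P x * Real.log (P x / Q x) : ℝ) : EReal) else ⊤

open Classical in
/-- The classical Rényi divergence `(α - 1)⁻¹ log ∑ x, (P x)^α (Q x)^(1-α)` of order
`α ∈ (0,1) ∪ (1,∞)` of a probability vector `P` and a nonnegative vector `Q`. It is `+∞` if
`P` and `Q` have disjoint supports (the value of `-log 0 / (1 - α)` for `α < 1`) and, for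
`α > 1`, also if `P ≪ Q` fails. -/
def classicalRenyiDiv {X : Type v} [Fintype X] (α : ℝ) (P Q : X → ℝ) : EReal :=
  if (∀ x, P x = 0 ∨ Q x = 0) ∨ (1 < α ∧ ¬ ∀ x, Q x = 0 → P x = 0) then ⊤
  else (((α - 1)⁻¹ * Real.log (∑ x, P x ^ α * Q x ^ (1 - α)) : ℝ) : EReal)

/-- A functional of pairs of operators on finite-dimensional systems, with values in `[-∞, ∞]`. -/
abbrev DivergenceFunctional :=
  ∀ (d : Type u) [Fintype d] [DecidableEq d], Matrix d d ℂ → Matrix d d ℂ → EReal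

/-- The measured divergence: supremum of the classical relative entropy over all POVMs on finite
outcome sets (which may be taken to be `Fin n`). -/
def measuredDiv : DivergenceFunctional.{u} :=
  fun d _ _ ρ σ => ⨆ (n : ℕ) (M : POVM (Fin n) d), classicalDiv (M.outcome ρ) (M.outcome σ)

/-- The measured Rényi divergence of order `α`. -/
def measuredRenyiDiv (α : ℝ) : DivergenceFunctional.{u} :=
  fun d _ _ ρ σ =>
    ⨆ (n : ℕ) (M : POVM (Fin n) d), classicalRenyiDiv α (M.outcome ρ) (M.outcome σ)

/-- A completely positive map is trace preserving (a quantum channel). -/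
def IsTracePreserving {A : Type u} {B : Type v} [Fintype A] [DecidableEq A] [Fintype B]
    [DecidableEq B] (N : Matrix A A ℂ →CP Matrix B B ℂ) : Prop :=
  ∀ X, (N X).trace = X.trace

/-- The action `N ⊗ id_R` on an operator of the system `A ⊗ R`, block by block. -/
def actWithReference {A : Type u} {B : Type v} {R : Type w} [Fintype A] [DecidableEq A] [Fintype B]
    [DecidableEq B] (N : Matrix A A ℂ →CP Matrix B B ℂ) (X : Matrix (A × R) (A × R) ℂ) :
    Matrix (B × R) (B × R) ℂ :=
  Matrix.of fun p q => N (Matrix.of fun a a' => X (a, p.2) (a', q.2)) p.1 q.1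

/-- The operator `N_{AE → B}(ρ_{AR} ⊗ σ_E)` on the system `B ⊗ R`: the tensor factors of
`ρ_{AR} ⊗ σ_E` are rearranged to `(A ⊗ E) ⊗ R`, and then `N ⊗ id_R` is applied. -/
def output {A E B R : Type*} [Fintype A] [DecidableEq A] [Fintype E] [DecidableEq E]
    [Fintype B] [DecidableEq B] (N : Matrix (A × E) (A × E) ℂ →CP Matrix B B ℂ)
    (ρ : Matrix (A × R) (A × R) ℂ) (σ : Matrix E E ℂ) : Matrix (B × R) (B × R) ℂ :=
  actWithReference N
    ((ρ ⊗ₖ σ).submatrix (fun p => ((p.1.1, p.2), p.1.2)) (fun p => ((p.1.1, p.2), p.1.2)))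

/-- The minimax channel divergence induced by a divergence `D`:
`sup_{ρ_AR} inf_{σ_E, ω_E} D(N(ρ_AR ⊗ σ_E) ‖ M(ρ_AR ⊗ ω_E))`, where the reference system `R`
ranges over all finite dimensions. -/
def minimaxDiv (D : DivergenceFunctional.{u}) {A : Type v} {E : Type w} {B : Type u}
    [Fintype A] [DecidableEq A] [Fintype E] [DecidableEq E] [Fintype B] [DecidableEq B]
    (N M : Matrix (A × E) (A × E) ℂ →CP Matrix B B ℂ) : EReal :=
  ⨆ (r : ℕ), ⨆ ρ ∈ Density (A × Fin r), ⨅ σ ∈ Density E, ⨅ ω ∈ Density E,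
    D (B × Fin r) (output N ρ σ) (output M ρ ω)

end MinimaxChannel

end

namespace MinimaxChannel

open Filter Topology

section Classical

/-! ### Classical Rényi divergences and their limit as the order tends to one. -/

variable {X : Type*} [Fintype X] {P Q : X → ℝ} {α β c : ℝ}

/-! The inequality `≤` is Jensen: `D_α ≤ D` outcome by outcome. For `≥`, fix `ρ`; the supremum over
`α` must be exchanged with the infimum over pairs `(σ, ω)`. No convexity in `(σ, ω)` is needed: the
measured Rényi divergences increase with `α` and are lower semicontinuous on the compact set of
pairs. If a real `c` exceeds the left side, their sublevel sets at `c` are nonempty, compact and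
nested, so one pair lies in all of them (`exists_forall_le_of_forall_exists_le`). Letting `α → 1`
for each POVM bounds the measured divergence of that pair by `c`
(`classicalDiv_le_of_forall_classicalRenyiDiv_le`). -/

lemma rpow_mul_rpow_one_sub {p q α : ℝ} (hp : 0 ≤ p) (hq : 0 ≤ q) (hα : 0 < α) :
    p ^ α * q ^ (1 - α) = p * (q / p) ^ (1 - α) := by
  rcases hp.eq_or_lt with rfl | hp
  · simp [Real.zero_rpow hα.ne']
  · rw [Real.div_rpow hq hp.le, Real.rpow_sub hp, Real.rpow_one]
    have := (Real.rpow_pos_of_pos hp α).ne'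
    field_simp

lemma renyiSum_nonneg (hP : 0 ≤ P) (hQ : 0 ≤ Q) :
    0 ≤ ∑ x, P x ^ α * Q x ^ (1 - α) :=
  Finset.sum_nonneg fun x _ =>
    mul_nonneg (Real.rpow_nonneg (hP x) _) (Real.rpow_nonneg (hQ x) _)

lemma renyiSum_eq_zero_iff (hα : α ∈ Set.Ioo (0 : ℝ) 1) (hP : 0 ≤ P) (hQ : 0 ≤ Q) :
    ∑ x, P x ^ α * Q x ^ (1 - α) = 0 ↔ ∀ x, P x = 0 ∨ Q x = 0 := by
  rw [Finset.sum_eq_zero_iff_of_nonneg fun x _ =>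
    mul_nonneg (Real.rpow_nonneg (hP x) _) (Real.rpow_nonneg (hQ x) _)]
  have h1 : 1 - α ≠ 0 := by linarith [hα.2]
  simp [Real.rpow_eq_zero (hP _) hα.1.ne', Real.rpow_eq_zero (hQ _) h1]

/-- Sublevel sets of the Rényi divergence in terms of the sum inside the logarithm. -/
lemma classicalRenyiDiv_le_coe_iff (hα : α ∈ Set.Ioo (0 : ℝ) 1) (hP : 0 ≤ P) (hQ : 0 ≤ Q) :
    classicalRenyiDiv α P Q ≤ (c : EReal) ↔
      Real.exp ((α - 1) * c) ≤ ∑ x, P x ^ α * Q x ^ (1 - α) := by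
  have hα1 : ¬ 1 < α := not_lt.mpr hα.2.le
  unfold classicalRenyiDiv
  simp only [hα1, false_and, or_false]
  split_ifs with h
  · rw [(renyiSum_eq_zero_iff hα hP hQ).mpr h]
    simp [Real.exp_pos]
  · have hS := (renyiSum_nonneg (α := α) hP hQ).lt_of_ne'
      (mt (renyiSum_eq_zero_iff hα hP hQ).mp h)
    rw [EReal.coe_le_coe_iff, ← Real.le_log_iff_exp_le hS]
    have h1 : α - 1 < 0 := by linarith [hα.2]
    rw [mul_comm, ← div_eq_mul_inv, div_le_iff_of_neg h1, mul_comm]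

/-- The Rényi divergence of a probability vector is monotone in the order. -/
lemma classicalRenyiDiv_mono (hα : α ∈ Set.Ioo (0 : ℝ) 1) (hβ : β ∈ Set.Ioo (0 : ℝ) 1)
    (hαβ : α ≤ β) (hP : 0 ≤ P) (hP1 : ∑ x, P x = 1) (hQ : 0 ≤ Q) :
    classicalRenyiDiv α P Q ≤ classicalRenyiDiv β P Q := by
  refine EReal.le_of_forall_lt_iff_le.mp fun c hc => ?_
  have hβc := (classicalRenyiDiv_le_coe_iff hβ hP hQ).mp hc.le
  rw [classicalRenyiDiv_le_coe_iff hα hP hQ]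
  have hs : 0 < 1 - α := by linarith [hα.2]
  have ht : 0 < 1 - β := by linarith [hβ.2]
  -- Jensen for `t ↦ t ^ r` with weights `P`: this power turns `(Q / P) ^ (1 - β)` into `(Q / P) ^
  -- (1 - α)`, and `exp ((β - 1) c)` into `exp ((α - 1) c)`.
  set r := (1 - α) / (1 - β) with hr
  have hr1 : 1 ≤ r := by rw [hr, one_le_div ht]; linarith
  have jensen := (convexOn_rpow hr1).map_sum_le (t := Finset.univ) (w := P)
    (p := fun x => (Q x / P x) ^ (1 - β)) (fun x _ => hP x) hP1
    (fun x _ => Real.rpow_nonneg (div_nonneg (hQ x) (hP x)) _)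
  simp only [smul_eq_mul] at jensen
  have e1 : ∀ x, P x * (Q x / P x) ^ (1 - β) = P x ^ β * Q x ^ (1 - β) := fun x =>
    (rpow_mul_rpow_one_sub (hP x) (hQ x) hβ.1).symm
  have e2 : ∀ x, P x * ((Q x / P x) ^ (1 - β)) ^ r = P x ^ α * Q x ^ (1 - α) := fun x => by
    rw [← Real.rpow_mul (div_nonneg (hQ x) (hP x)), hr, mul_div_cancel₀ _ ht.ne',
      rpow_mul_rpow_one_sub (hP x) (hQ x) hα.1]
  simp only [e1, e2] at jensen
  refine le_trans ?_ jensen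
  refine le_trans (le_of_eq ?_) (Real.rpow_le_rpow (Real.exp_pos _).le hβc (by linarith))
  rw [← Real.exp_mul, hr]
  congr 1
  field_simp
  ring

/-- The Rényi divergences of order less than one are bounded by the relative entropy. -/
lemma classicalRenyiDiv_le_classicalDiv (hα : α ∈ Set.Ioo (0 : ℝ) 1) (hP : 0 ≤ P)
    (hP1 : ∑ x, P x = 1) (hQ : 0 ≤ Q) :
    classicalRenyiDiv α P Q ≤ classicalDiv P Q := by
  unfold classicalDiv
  split_ifs with h
  swap
  · exact le_top
  rw [classicalRenyiDiv_le_coe_iff hα hP hQ]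
  have jensen := convexOn_exp.map_sum_le (t := Finset.univ) (w := P)
    (p := fun x => (α - 1) * Real.log (P x / Q x)) (fun x _ => hP x) hP1
    (fun x _ => Set.mem_univ _)
  simp only [smul_eq_mul] at jensen
  refine le_trans (le_of_eq ?_) (jensen.trans (Finset.sum_le_sum fun x _ => ?_))
  · rw [Finset.mul_sum]
    congr 1
    exact Finset.sum_congr rfl fun x _ => by ring
  · rw [rpow_mul_rpow_one_sub (hP x) (hQ x) hα.1]
    rcases (hP x).eq_or_lt with h0 | h0
    · simp [← h0]
    · have hq : 0 < Q x := (hQ x).lt_of_ne' fun hq => h0.ne' (h x hq)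
      refine mul_le_mul_of_nonneg_left (le_of_eq ?_) h0.le
      rw [Real.rpow_def_of_pos (div_pos hq h0), ← inv_div, Real.log_inv]
      congr 1
      ring

/-- The relative entropy is the limit of the Rényi divergences as the order tends to one. -/
lemma classicalDiv_le_of_forall_classicalRenyiDiv_le (hP : 0 ≤ P) (hP1 : ∑ x, P x = 1)
    (hQ : 0 ≤ Q) (h : ∀ α ∈ Set.Ioo (0 : ℝ) 1, classicalRenyiDiv α P Q ≤ (c : EReal)) :
    classicalDiv P Q ≤ (c : EReal) := by
  -- the ratios `Q / P`, with a positive dummy value where `P` vanishes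
  classical
  set y : X → ℝ := fun x => if P x = 0 then 1 else Q x / P x with hy
  -- Here `s = 1 - α`, so `α → 1` becomes `s → 0` from the right.
  have key : ∀ s ∈ Set.Ioo (0 : ℝ) 1, Real.exp (-c * s) ≤ ∑ x, P x * y x ^ s := by
    intro s hs
    have hs' : 1 - s ∈ Set.Ioo (0 : ℝ) 1 := ⟨by linarith [hs.2], by linarith [hs.1]⟩
    have := (classicalRenyiDiv_le_coe_iff hs' hP hQ).mp (h _ hs')
    refine le_trans (le_of_eq ?_) (this.trans (le_of_eq ?_))
    · congr 1; ring
    · refine Finset.sum_congr rfl fun x _ => ?_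
      rw [rpow_mul_rpow_one_sub (hP x) (hQ x) hs'.1, sub_sub_cancel]
      by_cases h0 : P x = 0 <;> simp [hy, h0]
  have hIoo : Set.Ioo (0 : ℝ) 1 ∈ 𝓝[>] (0 : ℝ) := Ioo_mem_nhdsGT one_pos
  by_cases hPQ : ∀ x, Q x = 0 → P x = 0
  · have hypos : ∀ x, 0 < y x := fun x => by
      by_cases h0 : P x = 0
      · simp [hy, h0]
      · simp only [hy, h0, if_false]
        exact div_pos ((hQ x).lt_of_ne' fun hq => h0 (hPQ x hq)) ((hP x).lt_of_ne' h0)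
    -- The difference of the two sides of `key` vanishes at `s = 0` and is nonnegative to the right,
    -- so its derivative there, `c - D(P‖Q)`, is nonnegative.
    have hd : HasDerivAt (fun s : ℝ => (∑ x, P x * y x ^ s) - Real.exp (-c * s))
        ((∑ x, P x * Real.log (y x)) + c) 0 := by
      have h1 : HasDerivAt (fun s : ℝ => ∑ x, P x * y x ^ s)
          (∑ x, P x * Real.log (y x)) 0 := by
        refine HasDerivAt.fun_sum fun x _ => HasDerivAt.const_mul _ ?_
        simpa using (Real.hasStrictDerivAt_const_rpow (hypos x) 0).hasDerivAt
      have h2 : HasDerivAt (fun s : ℝ => Real.exp (-c * s)) (-c) 0 := by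
        simpa using ((hasDerivAt_id (0 : ℝ)).const_mul (-c)).exp
      simpa using h1.fun_sub h2
    have hnn : 0 ≤ (∑ x, P x * Real.log (y x)) + c := by
      refine ge_of_tendsto hd.tendsto_slope_zero_right ?_
      filter_upwards [hIoo] with s hs
      have := key s hs
      simp only [zero_add, Real.rpow_zero, mul_one, hP1, mul_zero, Real.exp_zero, sub_self,
        sub_zero, smul_eq_mul]
      exact mul_nonneg (inv_nonneg.mpr hs.1.le) (sub_nonneg.mpr this)
    unfold classicalDiv
    rw [if_pos hPQ, EReal.coe_le_coe_iff]
    have : ∑ x, P x * Real.log (P x / Q x) = -∑ x, P x * Real.log (y x) := by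
      rw [← Finset.sum_neg_distrib]
      refine Finset.sum_congr rfl fun x _ => ?_
      by_cases h0 : P x = 0
      · simp [h0]
      · simp only [hy, h0, if_false]
        rw [← inv_div (Q x), Real.log_inv, mul_neg]
    linarith
  · exfalso
    push Not at hPQ
    obtain ⟨x₀, hq, hp⟩ := hPQ
    have hy0 : y x₀ = 0 := by simp [hy, hp, hq]
    -- Since `0 ^ s = 0` for `s > 0`, the limit loses the mass of `P` where `Q` vanishes and falls
    -- below 1, whereas the left side of `key` tends to 1.
    have hlim : Tendsto (fun s : ℝ => ∑ x, P x * y x ^ s) (𝓝[>] 0)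
        (𝓝 (∑ x, P x * if y x = 0 then 0 else 1)) := by
      refine tendsto_finsetSum _ fun x _ => Tendsto.const_mul _ ?_
      by_cases h0 : y x = 0
      · rw [if_pos h0]
        refine tendsto_const_nhds.congr' ?_
        filter_upwards [hIoo] with s hs
        rw [h0, Real.zero_rpow hs.1.ne']
      · rw [if_neg h0, ← Real.rpow_zero (y x)]
        exact (Real.continuousAt_const_rpow h0).tendsto.mono_left nhdsWithin_le_nhds
    have hexp : Tendsto (fun s : ℝ => Real.exp (-c * s)) (𝓝[>] 0) (𝓝 1) := by
      have : Continuous fun s : ℝ => Real.exp (-c * s) := by fun_prop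
      simpa using (this.tendsto 0).mono_left nhdsWithin_le_nhds
    have hle := le_of_tendsto_of_tendsto hexp hlim
      (by filter_upwards [hIoo] with s hs using key s hs)
    have hlt : ∑ x, P x * (if y x = 0 then (0 : ℝ) else 1) < ∑ x, P x := by
      refine Finset.sum_lt_sum (fun x _ => ?_) ⟨x₀, Finset.mem_univ _, ?_⟩
      · split_ifs
        · simpa using hP x
        · simp
      · simpa [hy0] using (hP x₀).lt_of_ne' hp
    linarith

end Classical

end MinimaxChannel

namespace MinimaxChannel

open Matrix

/-! ### State space, measurement outcomes and channel outputs. -/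

section Quantum

/-- Density operators are the image of the Frobenius unit sphere under `B ↦ Bᴴ * B`. -/
lemma isCompact_density (d : Type*) [Fintype d] [DecidableEq d] : IsCompact (Density d) := by
  have himg : Density d = (fun B : Matrix d d ℂ => Bᴴ * B) '' {B | (Bᴴ * B).trace = 1} := by
    ext ρ
    constructor
    · rintro ⟨hρ, htr⟩
      obtain ⟨B, rfl⟩ := CStarAlgebra.nonneg_iff_eq_star_mul_self.mp hρ.nonneg
      exact ⟨B, htr, rfl⟩
    · rintro ⟨B, hB, rfl⟩
      exact ⟨posSemidef_conjTranspose_mul_self B, hB⟩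
  have hcont : Continuous fun B : Matrix d d ℂ => Bᴴ * B := by fun_prop
  rw [himg]
  refine IsCompact.image ?_ hcont
  have hsub : {B : Matrix d d ℂ | (Bᴴ * B).trace = 1} ⊆
      Set.univ.pi fun _ => Set.univ.pi fun _ => Metric.closedBall (0 : ℂ) 1 := by
    intro B hB i _ j _
    have h1 : ∑ j, ∑ i, ‖B i j‖ ^ 2 = 1 := by
      have h2 : ((∑ j, ∑ i, ‖B i j‖ ^ 2 : ℝ) : ℂ) = 1 := by
        rw [← (show (Bᴴ * B).trace = 1 from hB)]
        simp only [trace, diag, mul_apply, conjTranspose_apply]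
        push_cast
        refine Finset.sum_congr rfl fun j _ => Finset.sum_congr rfl fun i _ => ?_
        exact (RCLike.conj_mul (B i j)).symm
      exact_mod_cast h2
    have h3 : ‖B i j‖ ^ 2 ≤ 1 := by
      rw [← h1]
      refine (Finset.single_le_sum (f := fun i => ‖B i j‖ ^ 2) (fun _ _ => by positivity)
        (Finset.mem_univ i)).trans ?_
      exact Finset.single_le_sum (f := fun j => ∑ i, ‖B i j‖ ^ 2) (fun _ _ => by positivity)
        (Finset.mem_univ j)
    rw [mem_closedBall_zero_iff]
    exact (sq_le_one_iff₀ (norm_nonneg _)).mp h3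
  refine IsCompact.of_isClosed_subset
    (isCompact_univ_pi fun _ => isCompact_univ_pi fun _ => isCompact_closedBall _ _) ?_ hsub
  exact isClosed_eq (by fun_prop) continuous_const

section POVM

variable {X d : Type*} [Fintype X] [Fintype d] [DecidableEq d]

lemma POVM.outcome_nonneg (M : POVM X d) {ρ : Matrix d d ℂ} (hρ : ρ.PosSemidef) :
    0 ≤ M.outcome ρ := by
  intro x
  obtain ⟨B, rfl⟩ := CStarAlgebra.nonneg_iff_eq_star_mul_self.mp hρ.nonneg
  have h := ((M.posSemidef x).mul_mul_conjTranspose_same B).trace_nonneg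
  simp only [POVM.outcome, Pi.zero_apply, star_eq_conjTranspose]
  -- Cyclicity gives the trace of the positive operator `B * M_x * Bᴴ`.
  rw [← Matrix.mul_assoc, trace_mul_comm, ← Matrix.mul_assoc]
  exact (Complex.le_def.mp h).1

lemma POVM.sum_outcome (M : POVM X d) (ρ : Matrix d d ℂ) :
    ∑ x, M.outcome ρ x = ρ.trace.re := by
  simp only [POVM.outcome]
  rw [← Complex.re_sum, ← trace_sum, ← Finset.sum_mul, M.sum_eq_one, one_mul]

lemma POVM.continuous_outcome (M : POVM X d) (x : X) :
    Continuous fun ρ : Matrix d d ℂ => M.outcome ρ x := by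
  unfold POVM.outcome
  fun_prop

end POVM

section Channel

variable {A E B : Type*} [Fintype A] [DecidableEq A] [Fintype E] [DecidableEq E]
  [Fintype B] [DecidableEq B]

/-- Grouping a matrix on `A ⊗ R` into `R × R` blocks preserves positivity. -/
lemma cstarMatrix_blocks_nonneg {R : Type*} [Fintype R] [DecidableEq R]
    {Z : Matrix (A × R) (A × R) ℂ} (hZ : Z.PosSemidef) :
    0 ≤ CStarMatrix.ofMatrix (Matrix.of fun r r' : R =>
      (Matrix.of fun a a' : A => Z (a, r) (a', r') : Matrix A A ℂ)) := by
  obtain ⟨Y, rfl⟩ := CStarAlgebra.nonneg_iff_eq_star_mul_self.mp hZ.nonneg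
  convert star_mul_self_nonneg (CStarMatrix.ofMatrix (Matrix.of fun r r' : R =>
      (Matrix.of fun a a' : A => Y (a, r) (a', r') : Matrix A A ℂ))) using 1
  ext r r' a a'
  simp [CStarMatrix.mul_apply, CStarMatrix.star_apply, Matrix.mul_apply, Matrix.sum_apply,
    Fintype.sum_prod_type_right]

/-- Nonnegative elements are sums of squares `star Y * Y`, and ungrouping the blocks respects
products and adjoints. -/
lemma posSemidef_of_cstarMatrix_nonneg {R : Type*} [Fintype R] [DecidableEq R]
    {Z : CStarMatrix R R (Matrix B B ℂ)} (hZ : 0 ≤ Z) :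
    (Matrix.of fun p q : B × R => Z p.2 q.2 p.1 q.1).PosSemidef := by
  rw [StarOrderedRing.nonneg_iff] at hZ
  induction hZ using AddSubmonoid.closure_induction with
  | zero => exact PosSemidef.zero
  | add Z W _ _ hZ hW => exact hZ.add hW
  | mem Z hZ =>
  obtain ⟨Y, rfl⟩ := hZ
  convert posSemidef_conjTranspose_mul_self (Matrix.of fun p q : B × R => Y p.2 q.2 p.1 q.1)
  ext p q
  simp [CStarMatrix.mul_apply, CStarMatrix.star_apply, Matrix.mul_apply, Matrix.sum_apply,
    Fintype.sum_prod_type_right]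

/-- Complete positivity is positivity on block matrices; regrouping transfers it to `N ⊗ id_R`. -/
lemma posSemidef_actWithReference {R : Type*} [Fintype R] [DecidableEq R]
    (N : Matrix A A ℂ →CP Matrix B B ℂ) {Z : Matrix (A × R) (A × R) ℂ} (hZ : Z.PosSemidef) :
    (actWithReference N Z).PosSemidef :=
  posSemidef_of_cstarMatrix_nonneg
    (CompletelyPositiveMap.map_cstarMatrix_nonneg N _ (cstarMatrix_blocks_nonneg hZ))

lemma trace_actWithReference {R : Type*} [Fintype R]
    {N : Matrix A A ℂ →CP Matrix B B ℂ} (hN : IsTracePreserving N)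
    (Z : Matrix (A × R) (A × R) ℂ) :
    (actWithReference N Z).trace = Z.trace := by
  simp only [trace, diag, Fintype.sum_prod_type_right, actWithReference, of_apply]
  exact Finset.sum_congr rfl fun r _ => hN _

lemma posSemidef_output {R : Type*} [Fintype R] [DecidableEq R]
    (N : Matrix (A × E) (A × E) ℂ →CP Matrix B B ℂ)
    {ρ : Matrix (A × R) (A × R) ℂ} (hρ : ρ.PosSemidef) {σ : Matrix E E ℂ} (hσ : σ.PosSemidef) :
    (output N ρ σ).PosSemidef :=
  posSemidef_actWithReference N ((hρ.kronecker hσ).submatrix _)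

lemma trace_output {R : Type*} [Fintype R] {N : Matrix (A × E) (A × E) ℂ →CP Matrix B B ℂ}
    (hN : IsTracePreserving N) (ρ : Matrix (A × R) (A × R) ℂ) (σ : Matrix E E ℂ) :
    (output N ρ σ).trace = ρ.trace * σ.trace := by
  rw [output, trace_actWithReference hN, ← trace_kronecker]
  simp only [trace, diag, submatrix_apply]
  exact Fintype.sum_equiv
    { toFun := fun p : (A × E) × R => ((p.1.1, p.2), p.1.2)
      invFun := fun p => ((p.1.1, p.2), p.1.2)
      left_inv := fun _ => rfl
      right_inv := fun _ => rfl } _ _ fun _ => rfl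

lemma continuous_output {R : Type*} [Fintype R]
    (N : Matrix (A × E) (A × E) ℂ →CP Matrix B B ℂ) (ρ : Matrix (A × R) (A × R) ℂ) :
    Continuous fun σ : Matrix E E ℂ => output N ρ σ := by
  have hN : Continuous N := N.toLinearMap.continuous_of_finiteDimensional
  refine continuous_matrix fun p q => Continuous.matrix_elem (hN.comp ?_) _ _
  refine continuous_matrix fun a a' => ?_
  simp only [of_apply, submatrix_apply, kronecker_apply]
  fun_prop

end Channel

end Quantum

/-! ### Exchange of supremum and infimum by compactness. -/

section Minimax

/-- A directed family of functions with closed sublevel sets on a compact set attains, up to any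
level, the infimum of its pointwise supremum. -/
lemma exists_forall_le_of_forall_exists_le {ι T : Type*} [TopologicalSpace T] [Nonempty ι]
    [SemilatticeSup ι] {K : Set T} (hK : IsCompact K) (f : ι → T → EReal) (c : EReal)
    (hcl : ∀ i, IsClosed {x | x ∈ K ∧ f i x ≤ c})
    (hmono : ∀ x ∈ K, Monotone fun i => f i x)
    (h : ∀ i, ∃ x ∈ K, f i x ≤ c) : ∃ x ∈ K, ∀ i, f i x ≤ c := by
  obtain ⟨x, hx⟩ := IsCompact.nonempty_iInter_of_directed_nonempty_isCompact_isClosed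
    (fun i => {x | x ∈ K ∧ f i x ≤ c})
    (directed_of_isDirected_le fun i j hij x hx => ⟨hx.1, (hmono x hx.1 hij).trans hx.2⟩)
    (fun i => (h i).imp fun x hx => hx)
    (fun i => hK.of_isClosed_subset (hcl i) fun x hx => hx.1) hcl
  rw [Set.mem_iInter] at hx
  exact ⟨x, (hx (Classical.arbitrary ι)).1, fun i => (hx i).2⟩

variable {d : Type*} [Fintype d] [DecidableEq d] {ρ σ : Matrix d d ℂ}

lemma measuredRenyiDiv_le_measuredDiv {α : ℝ} (hα : α ∈ Set.Ioo (0 : ℝ) 1)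
    (hρ : ρ ∈ Density d) (hσ : σ.PosSemidef) :
    measuredRenyiDiv α d ρ σ ≤ measuredDiv d ρ σ :=
  iSup₂_mono fun n M => classicalRenyiDiv_le_classicalDiv hα (M.outcome_nonneg hρ.1)
    (by rw [M.sum_outcome, hρ.2, Complex.one_re]) (M.outcome_nonneg hσ)

lemma measuredRenyiDiv_mono {α β : ℝ} (hα : α ∈ Set.Ioo (0 : ℝ) 1) (hβ : β ∈ Set.Ioo (0 : ℝ) 1)
    (hαβ : α ≤ β) (hρ : ρ ∈ Density d) (hσ : σ.PosSemidef) :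
    measuredRenyiDiv α d ρ σ ≤ measuredRenyiDiv β d ρ σ :=
  iSup₂_mono fun n M => classicalRenyiDiv_mono hα hβ hαβ (M.outcome_nonneg hρ.1)
    (by rw [M.sum_outcome, hρ.2, Complex.one_re]) (M.outcome_nonneg hσ)

/-- Suprema over `α` and over POVMs commute, so the classical limit is taken for each POVM
separately. -/
lemma measuredDiv_le_of_forall_measuredRenyiDiv_le {c : ℝ} (hρ : ρ ∈ Density d)
    (hσ : σ.PosSemidef)
    (h : ∀ α ∈ Set.Ioo (0 : ℝ) 1, measuredRenyiDiv α d ρ σ ≤ (c : EReal)) :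
    measuredDiv d ρ σ ≤ (c : EReal) :=
  iSup₂_le fun n M => classicalDiv_le_of_forall_classicalRenyiDiv_le (M.outcome_nonneg hρ.1)
    (by rw [M.sum_outcome, hρ.2, Complex.one_re]) (M.outcome_nonneg hσ)
    fun α hα => (le_iSup₂ (f := fun (n : ℕ) (M : POVM (Fin n) d) =>
      classicalRenyiDiv α (M.outcome ρ) (M.outcome σ)) n M).trans (h α hα)

/-- Along continuous families of positive semidefinite operators the measured Rényi divergence has
closed sublevel sets. -/
lemma isClosed_setOf_measuredRenyiDiv_le {T : Type*} [TopologicalSpace T] {K : Set T}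
    (hK : IsClosed K) {f g : T → Matrix d d ℂ} (hf : Continuous f) (hg : Continuous g)
    (hf0 : ∀ x ∈ K, (f x).PosSemidef) (hg0 : ∀ x ∈ K, (g x).PosSemidef) {α : ℝ}
    (hα : α ∈ Set.Ioo (0 : ℝ) 1) (c : ℝ) :
    IsClosed {x | x ∈ K ∧ measuredRenyiDiv α d (f x) (g x) ≤ (c : EReal)} := by
  have heq : {x | x ∈ K ∧ measuredRenyiDiv α d (f x) (g x) ≤ (c : EReal)} =
      K ∩ ⋂ (n : ℕ) (M : POVM (Fin n) d), {x | Real.exp ((α - 1) * c) ≤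
        ∑ i, M.outcome (f x) i ^ α * M.outcome (g x) i ^ (1 - α)} := by
    ext x
    simp only [Set.mem_inter_iff, Set.mem_iInter, Set.mem_ofPred_eq]
    refine and_congr_right fun hx => ?_
    simp only [measuredRenyiDiv, iSup_le_iff]
    exact forall₂_congr fun n M => classicalRenyiDiv_le_coe_iff hα
      (M.outcome_nonneg (hf0 x hx)) (M.outcome_nonneg (hg0 x hx))
  rw [heq]
  refine hK.inter (isClosed_iInter fun n => isClosed_iInter fun M =>
    isClosed_le continuous_const (continuous_finsetSum _ fun i _ => ?_))
  -- Both exponents are nonnegative, so the powers stay continuous where an outcome has weight zero.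
  exact (((M.continuous_outcome i).comp hf).rpow_const fun _ => Or.inr hα.1.le).mul
    (((M.continuous_outcome i).comp hg).rpow_const fun _ => Or.inr (by linarith [hα.2]))

end Minimax

end MinimaxChannel

theorem mainTheorem7 {A E B : Type*} [Fintype A] [DecidableEq A] [Fintype E] [DecidableEq E]
    [Fintype B] [DecidableEq B]
    (N M : Matrix (A × E) (A × E) ℂ →CP Matrix B B ℂ)
    (hN : MinimaxChannel.IsTracePreserving N) :
    (⨆ α ∈ Set.Ioo (0 : ℝ) 1,
        MinimaxChannel.minimaxDiv (MinimaxChannel.measuredRenyiDiv α) N M) =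
      MinimaxChannel.minimaxDiv MinimaxChannel.measuredDiv N M := by
  open MinimaxChannel in
  have hNout : ∀ {r : ℕ} {ρ : Matrix (A × Fin r) (A × Fin r) ℂ} {σ : Matrix E E ℂ},
      ρ ∈ Density (A × Fin r) → σ ∈ Density E → output N ρ σ ∈ Density (B × Fin r) :=
    fun hρ hσ => ⟨posSemidef_output N hρ.1 hσ.1, by
      rw [trace_output hN, hρ.2, hσ.2, one_mul]⟩
  apply le_antisymm
  · refine iSup₂_le fun α hα => iSup_mono fun r => iSup₂_mono fun ρ hρ => iInf₂_mono fun σ hσ =>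
      iInf₂_mono fun ω hω => ?_
    exact measuredRenyiDiv_le_measuredDiv hα (hNout hρ hσ) (posSemidef_output M hρ.1 hω.1)
  · refine iSup_le fun r => iSup₂_le fun ρ hρ => EReal.le_of_forall_lt_iff_le.mp fun c hc => ?_
    have : Nonempty (Set.Ioo (0 : ℝ) 1) := ⟨⟨1 / 2, by norm_num, by norm_num⟩⟩
    obtain ⟨⟨σ, ω⟩, ⟨hσ, hω⟩, hle⟩ := exists_forall_le_of_forall_exists_le
      (ι := Set.Ioo (0 : ℝ) 1) ((isCompact_density E).prod (isCompact_density E))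
      (fun α x => measuredRenyiDiv α (B × Fin r) (output N ρ x.1) (output M ρ x.2)) c
      (fun α => isClosed_setOf_measuredRenyiDiv_le
        ((isCompact_density E).prod (isCompact_density E)).isClosed
        ((continuous_output N ρ).comp continuous_fst)
        ((continuous_output M ρ).comp continuous_snd)
        (fun x hx => posSemidef_output N hρ.1 hx.1.1)
        (fun x hx => posSemidef_output M hρ.1 hx.2.1) α.2 c)
      (fun x hx α β hαβ => measuredRenyiDiv_mono α.2 β.2 hαβ (hNout hρ hx.1)
        (posSemidef_output M hρ.1 hx.2.1))
      (fun α => by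
        have hα : (⨅ σ ∈ Density E, ⨅ ω ∈ Density E,
            measuredRenyiDiv α (B × Fin r) (output N ρ σ) (output M ρ ω)) < c := by
          -- The strict bound yields a pair below `c` without the infimum being attained.
          refine lt_of_le_of_lt ?_ hc
          refine le_trans ?_ (le_iSup₂ (f := fun (α : ℝ) (_ : α ∈ Set.Ioo (0 : ℝ) 1) =>
            minimaxDiv (measuredRenyiDiv α) N M) (α : ℝ) α.2)
          refine le_trans ?_ (le_iSup _ r)
          exact le_iSup₂ (f := fun ρ (_ : ρ ∈ Density (A × Fin r)) =>
            ⨅ σ ∈ Density E, ⨅ ω ∈ Density E,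
              measuredRenyiDiv α (B × Fin r) (output N ρ σ) (output M ρ ω)) ρ hρ
        simp only [iInf_lt_iff] at hα
        obtain ⟨σ, hσ, ω, hω, h⟩ := hα
        exact ⟨(σ, ω), ⟨hσ, hω⟩, h.le⟩)
    refine (iInf₂_le_of_le σ hσ (iInf₂_le_of_le ω hω ?_))
    exact measuredDiv_le_of_forall_measuredRenyiDiv_le (hNout hρ hσ)
      (posSemidef_output M hρ.1 hω.1) fun α hα => hle ⟨α, hα⟩
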